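/- Let $(\Omega,\mathfrak F,P)$ be a probability space, $(M,\mathfrak B)$ a measurable space, and let time be discrete, $\mathbb T=\mathbb Z$ or $\mathbb T=\mathbb Z^+=\{0,1,2,\dots\}$. Let $\{\theta_t\}_{t\in\mathbb T}$ be measurable $P$-preserving transformations of $\Omega$ with $\theta_0=\mathrm{id}$ and $\theta_{t+s}=\theta_t\circ\theta_s$, and let $T:\Omega\times\mathbb T\times M\to M$, written $T_\omega^t x=T(\omega,t,x)$, be a measurable cocycle over $\theta$, that is, $T_\omega^0=\mathrm{id}_M$ and $T_\omega^{t+s}=T_{\theta_s\omega}^t\circ T_\omega^s$ (a random dynamical system). Assume that the system is stationary with stationary distribution $\mu$, a probability measure on $(M,\mathfrak B)$. This means that: (i) The processes $(T_\omega^t x)_{t\ge 0}$, $x\in M$, form a time-homogeneous Markov family: for all $x\in M$, $s,t\ge 0$ and $A\in\mathfrak B$, \[P\big(T_\omega^{s+t}x\in A \,\big|\, \sigma(T_\omega^r x : 0\le r\le s)\big)=P(T_\omega^s x,A,t)\quad P\text{-a.s.},\] where $P(y,A,t)=P\{\omega' : T_{\omega'}^t y\in A\}$. (ii) $\mu$ is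 invariant: $\int_\Omega \mu\big((T_\omega^t)^{-1}A\big)\,dP(\omega)=\mu(A)$ for all $t\ge 0$ and $A\in\mathfrak B$. Call $A\in\mathfrak B$ invariant if $\int_A\int_\Omega \chi_A(T_\omega^t x)\,dP(\omega)\,d\mu(x)=\mu(A)$ for all $t\ge 0$. The invariant sets form a $\sigma$-algebra $\mathfrak I$ on $M$. Let $k\ge 0$, let $t_1,\dots,t_k\in\mathbb T$ be nonnegative, let $\hat f:M^k\to\mathbb C$ be $\mathfrak B^k$-measurable, put \[f(x,\omega)=\hat f(T_\omega^{t_1}x,\dots,T_\omega^{t_k}x),\] and assume $\int_M\int_\Omega |f|\,dP\,d\mu<\infty$. Write $x_j=T_{\omega_0}^j x_0$ and $\omega_j=\theta_j\omega_0$. Then for $(\mu\times P)$-almost every initial condition $(x_0,\omega_0)$, \[\lim_{n\to\infty}\frac1n\sum_{j=0}^{n-1}f(x_j,\omega_j)=\mathbb E_\mu\Big(\int_\Omega f(\cdot,\omega)\,dP(\omega)\,\Big|\,\mathfrak I\Big)(x_0).\] If moreover the system is ergodic, i.e. every invariant set has $\mu$-measure $0$ or $1$, then for $(\mu\times P)$-almost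 every $(x_0,\omega_0)$, \[\lim_{n\to\infty}\frac1n\sum_{j=0}^{n-1}f(x_j,\omega_j)=\int_M\int_\Omega f(x,\omega)\,dP(\omega)\,d\mu(x).\] -/

import Mathlib

open MeasureTheory Filter Topology

/-- The linearly ordered time set `𝕋` is discrete: its nonnegative times are exactly
`0, 1, 2, …`. This covers `𝕋 = ℤ⁺ = {0, 1, 2, …}` and `𝕋 = ℤ`, as shown just below. -/
def IsDiscreteTime (𝕋 : Type*) [CommSemiring 𝕋] [LinearOrder 𝕋] [IsStrictOrderedRing 𝕋] : Prop :=
  ∀ t : 𝕋, 0 ≤ t → ∃ n : ℕ, (n : 𝕋) = t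

theorem isDiscreteTime_nat : IsDiscreteTime ℕ := fun t _ => ⟨t, rfl⟩

theorem isDiscreteTime_int : IsDiscreteTime ℤ := fun t ht => ⟨t.toNat, Int.toNat_of_nonneg ht⟩

/-- A random dynamical system on `M` over the probability space `(Ω, P)` with time `𝕋`: a
measure-preserving driving flow `θ` on `Ω`, and a jointly measurable cocycle `T` over `θ`
(`T ω t x` is `T_ω^t x`). -/
structure RandomDynamicalSystem (𝕋 M : Type*) {Ω : Type*} [AddMonoid 𝕋] [MeasurableSpace 𝕋]
    [MeasurableSpace M] [MeasurableSpace Ω] (P : Measure Ω) where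
  θ : 𝕋 → Ω → Ω
  θ_measurePreserving : ∀ t, MeasurePreserving (θ t) P P
  θ_zero : θ 0 = id
  θ_add : ∀ t s, θ (t + s) = θ t ∘ θ s
  T : Ω → 𝕋 → M → M
  measurable_T : Measurable fun p : Ω × 𝕋 × M => T p.1 p.2.1 p.2.2
  T_zero : ∀ ω, T ω 0 = id
  T_add : ∀ ω t s, T ω (t + s) = T (θ s ω) t ∘ T ω s

namespace RandomDynamicalSystem

variable {𝕋 M Ω : Type*} [CommSemiring 𝕋] [LinearOrder 𝕋] [MeasurableSpace 𝕋]
  [MeasurableSpace M] [MeasurableSpace Ω] {P : Measure Ω}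

/-- The `σ`-algebra on `Ω` generated by the past `T_ω^r x`, `0 ≤ r ≤ s`, of the process started
at `x`. -/
abbrev past (D : RandomDynamicalSystem 𝕋 M P) (x : M) (s : 𝕋) : MeasurableSpace Ω :=
  ⨆ r ∈ Set.Icc 0 s, MeasurableSpace.comap (fun ω => D.T ω r x) inferInstance

/-- The transition probability `P(x, A, t) = P {ω | T_ω^t x ∈ A}`. -/
noncomputable def transitionProb (D : RandomDynamicalSystem 𝕋 M P) (x : M) (A : Set M) (t : 𝕋) :
    ℝ :=
  P.real {ω | D.T ω t x ∈ A}

/-- The processes `x_t = T_ω^t x`, `t ≥ 0`, `x ∈ M`, form a time-homogeneous Markov family: the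
conditional probability of `x_{s+t} ∈ A` given the past up to time `s` is `P(x_s, A, t)`. -/
def IsMarkovFamily (D : RandomDynamicalSystem 𝕋 M P) : Prop :=
  ∀ (x : M) (s t : 𝕋), 0 ≤ s → 0 ≤ t → ∀ A : Set M, MeasurableSet A →
    P[{ω | D.T ω (s + t) x ∈ A}.indicator (fun _ => (1 : ℝ)) | D.past x s]
      =ᵐ[P] fun ω => D.transitionProb (D.T ω s x) A t

/-- `μ` is an invariant measure of the (weakly measure preserving) system:
`𝔼 (μ ((T_ω^t)⁻¹ A)) = μ A` for all `t ≥ 0` and all measurable `A`. -/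
def IsInvariantMeasure (D : RandomDynamicalSystem 𝕋 M P) (μ : Measure M) : Prop :=
  ∀ t : 𝕋, 0 ≤ t → ∀ A : Set M, MeasurableSet A → ∫⁻ ω, μ (D.T ω t ⁻¹' A) ∂P = μ A

/-- The system is stationary with stationary distribution `μ`: it is a time-homogeneous Markov
family and `μ` is an invariant measure. -/
structure IsStationary (D : RandomDynamicalSystem 𝕋 M P) (μ : Measure M) : Prop where
  markov : D.IsMarkovFamily
  invariant : D.IsInvariantMeasure μ

/-- A measurable set `A` is invariant if `∫_A ∫_Ω χ_A (T_ω^t x) dP dμ = μ A` for all `t ≥ 0`. -/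
def IsInvariantSet (D : RandomDynamicalSystem 𝕋 M P) (μ : Measure M) (A : Set M) : Prop :=
  MeasurableSet A ∧ ∀ t : 𝕋, 0 ≤ t →
    ∫⁻ x in A, ∫⁻ ω, A.indicator (fun _ => 1) (D.T ω t x) ∂P ∂μ = μ A

theorem measurable_map (D : RandomDynamicalSystem 𝕋 M P) (t : 𝕋) :
    Measurable fun p : M × Ω => D.T p.2 t p.1 :=
  D.measurable_T.comp (measurable_snd.prodMk (measurable_const.prodMk measurable_fst))

theorem measurable_indicator_map (D : RandomDynamicalSystem 𝕋 M P) (t : 𝕋) {A : Set M}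
    (hA : MeasurableSet A) :
    Measurable fun p : M × Ω => A.indicator (fun _ => (1 : ENNReal)) (D.T p.2 t p.1) :=
  (measurable_const.indicator hA).comp (D.measurable_map t)

theorem measurable_lintegral_indicator [IsProbabilityMeasure P]
    (D : RandomDynamicalSystem 𝕋 M P) (t : 𝕋) {A : Set M} (hA : MeasurableSet A) :
    Measurable fun x => ∫⁻ ω, A.indicator (fun _ => (1 : ENNReal)) (D.T ω t x) ∂P :=
  (D.measurable_indicator_map t hA).lintegral_prod_right'

theorem lintegral_indicator_le_one [IsProbabilityMeasure P]
    (D : RandomDynamicalSystem 𝕋 M P) (t : 𝕋) (A : Set M) (x : M) :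
    ∫⁻ ω, A.indicator (fun _ => (1 : ENNReal)) (D.T ω t x) ∂P ≤ 1 := by
  calc _ ≤ ∫⁻ _, 1 ∂P := lintegral_mono fun ω => by
        by_cases h : D.T ω t x ∈ A <;> simp [h]
    _ = 1 := by simp

theorem isInvariantSet_iff_ae [IsProbabilityMeasure P] (D : RandomDynamicalSystem 𝕋 M P)
    (μ : Measure M) [IsFiniteMeasure μ] {A : Set M} (hA : MeasurableSet A) :
    D.IsInvariantSet μ A ↔ ∀ t : 𝕋, 0 ≤ t → ∀ᵐ x ∂μ, x ∈ A →
      1 ≤ ∫⁻ ω, A.indicator (fun _ => (1 : ENNReal)) (D.T ω t x) ∂P := by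
  refine ⟨fun h t ht => ?_, fun h => ⟨hA, fun t ht => ?_⟩⟩
  · rw [← ae_restrict_iff' hA]
    have h2 := ae_eq_of_ae_le_of_lintegral_le (μ := μ.restrict A)
      (Eventually.of_forall (D.lintegral_indicator_le_one t A))
      (by rw [h.2 t ht]; exact measure_ne_top _ _) aemeasurable_const
      (by rw [h.2 t ht]; simp)
    filter_upwards [h2] with x hx using hx.ge
  · have h1 := h t ht
    rw [← ae_restrict_iff' hA] at h1
    calc _ = ∫⁻ _ in A, 1 ∂μ := lintegral_congr_ae (by
            filter_upwards [h1] with x hx using le_antisymm (D.lintegral_indicator_le_one t A x) hx)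
      _ = μ A := by simp

theorem IsInvariantSet.compl [IsProbabilityMeasure P] {D : RandomDynamicalSystem 𝕋 M P}
    {μ : Measure M} [IsProbabilityMeasure μ] (hD : D.IsStationary μ) {A : Set M}
    (h : D.IsInvariantSet μ A) : D.IsInvariantSet μ Aᶜ := by
  have hA := h.1
  refine ⟨hA.compl, fun t ht => ?_⟩
  have htot : ∫⁻ x, ∫⁻ ω, A.indicator (fun _ => (1 : ENNReal)) (D.T ω t x) ∂P ∂μ = μ A := by
    rw [lintegral_lintegral_swap (D.measurable_indicator_map t hA).aemeasurable,
      ← hD.invariant t ht A hA]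
    refine lintegral_congr fun ω => ?_
    have hm : Measurable (D.T ω t) := (D.measurable_map t).comp (measurable_id.prodMk measurable_const)
    rw [← lintegral_indicator_one (hm hA)]
    rfl
  have hzero : ∫⁻ x in Aᶜ, ∫⁻ ω, A.indicator (fun _ => (1 : ENNReal)) (D.T ω t x) ∂P ∂μ = 0 := by
    have h1 := lintegral_add_compl (μ := μ)
      (fun x => ∫⁻ ω, A.indicator (fun _ => (1 : ENNReal)) (D.T ω t x) ∂P) hA
    rw [h.2 t ht, htot] at h1
    exact (ENNReal.add_right_inj (measure_ne_top μ A)).1 (h1.trans (add_zero _).symm)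
  calc ∫⁻ x in Aᶜ, ∫⁻ ω, Aᶜ.indicator (fun _ => (1 : ENNReal)) (D.T ω t x) ∂P ∂μ
      = ∫⁻ x in Aᶜ, ∫⁻ ω, Aᶜ.indicator (fun _ => (1 : ENNReal)) (D.T ω t x) ∂P ∂μ
        + ∫⁻ x in Aᶜ, ∫⁻ ω, A.indicator (fun _ => (1 : ENNReal)) (D.T ω t x) ∂P ∂μ := by
        rw [hzero, add_zero]
    _ = ∫⁻ x in Aᶜ, 1 ∂μ := by
        rw [← lintegral_add_left (D.measurable_lintegral_indicator t hA.compl)]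
        refine lintegral_congr fun x => ?_
        have hm : Measurable fun ω => Aᶜ.indicator (fun _ => (1 : ENNReal)) (D.T ω t x) :=
          (D.measurable_indicator_map t hA.compl).comp measurable_prodMk_left
        rw [← lintegral_add_left hm]
        calc _ = ∫⁻ _, 1 ∂P := lintegral_congr fun ω => by
                by_cases hx : D.T ω t x ∈ A <;> simp [hx]
          _ = 1 := by simp
    _ = μ Aᶜ := by simp

theorem IsInvariantSet.iUnion [IsProbabilityMeasure P] {D : RandomDynamicalSystem 𝕋 M P}
    {μ : Measure M} [IsProbabilityMeasure μ] {A : ℕ → Set M}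
    (h : ∀ i, D.IsInvariantSet μ (A i)) : D.IsInvariantSet μ (⋃ i, A i) := by
  rw [D.isInvariantSet_iff_ae μ (MeasurableSet.iUnion fun i => (h i).1)]
  intro t ht
  have h' := fun i => (D.isInvariantSet_iff_ae μ (h i).1).1 (h i) t ht
  filter_upwards [ae_all_iff.2 h'] with x hx hxA
  obtain ⟨i, hi⟩ := Set.mem_iUnion.1 hxA
  exact (hx i hi).trans (lintegral_mono fun ω =>
    Set.indicator_le_indicator_of_subset (Set.subset_iUnion A i) (fun _ => zero_le) _)

/-- The `σ`-algebra `ℑ` of invariant sets of a stationary random dynamical system. -/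
abbrev invariantSigmaAlgebra [IsProbabilityMeasure P] (D : RandomDynamicalSystem 𝕋 M P)
    (μ : Measure M) [IsProbabilityMeasure μ] (hD : D.IsStationary μ) : MeasurableSpace M where
  MeasurableSet' := D.IsInvariantSet μ
  measurableSet_empty := ⟨MeasurableSet.empty, by simp⟩
  measurableSet_compl _ h := h.compl hD
  measurableSet_iUnion _ h := IsInvariantSet.iUnion h

theorem invariantSigmaAlgebra_le [IsProbabilityMeasure P]
    (D : RandomDynamicalSystem 𝕋 M P) (μ : Measure M) [IsProbabilityMeasure μ]
    (hD : D.IsStationary μ) : D.invariantSigmaAlgebra μ hD ≤ ‹MeasurableSpace M› :=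
  fun _ h => h.1

/-- The system is ergodic if every invariant set has measure `0` or `1`. -/
def IsErgodic (D : RandomDynamicalSystem 𝕋 M P) (μ : Measure M) : Prop :=
  ∀ A : Set M, D.IsInvariantSet μ A → μ A = 0 ∨ μ A = 1

/-- The function `f(x, ω) = f̂(T_ω^{t₁} x, …, T_ω^{t_k} x)`. -/
def multiTime (D : RandomDynamicalSystem 𝕋 M P) {k : ℕ} (t : Fin k → 𝕋) (fhat : (Fin k → M) → ℂ)
    (x : M) (ω : Ω) : ℂ :=
  fhat fun i => D.T ω (t i) x

/-- The time average `(1/n) ∑_{j<n} f(x_j, ω_j)` along the trajectory `x_j = T_ω^j x`,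
`ω_j = θ_j ω`. -/
noncomputable def timeAverage (D : RandomDynamicalSystem 𝕋 M P) (f : M → Ω → ℂ) (n : ℕ) (x : M)
    (ω : Ω) : ℂ :=
  1 / (n : ℂ) * ∑ j ∈ Finset.range n, f (D.T ω (j : 𝕋) x) (D.θ (j : 𝕋) ω)

end RandomDynamicalSystem

/-! Since `f` depends on `ω` only through the trajectory, the problem moves to path space. There `μ
× P` becomes the law `ν` of a Markov chain started from `μ`. By the cocycle property the time
averages of `f` are Birkhoff averages of a path function `F` under the shift. The Markov property
and invariance of `μ` make the shift preserve `ν`.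

The limit is identified by matching shift-invariant path events with `ℑ`. If `B` is shift-invariant
and `h x` is the probability of `B` from `x`, then `h (y n)` is the conditional probability of `B`
given the path up to time `n`. By Lévy's upward theorem it tends to `1_B` in `L¹`. By stationarity
its `L¹` distance to `1_B` does not depend on `n`, so it is zero, and `B` is a.e. the event of
starting in `{h = 1}`, an invariant set. Conversely, a function `c` measurable for `ℑ` is a.e.
constant along paths.

With `c` the conditional expectation, `F y - c (y 0)` therefore has zero integral over every
shift-invariant event, so Birkhoff's theorem is needed only for such functions. The maximal ergodic
theorem yields that case. -/

/-! ### Maximal and pointwise ergodic theorems. -/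

section Birkhoff

variable {X : Type*}

/-- The running maximum of the Birkhoff sums `0, S₁ g, S₂ g, …`, in recursive form. -/
noncomputable def maxBirkhoffSum (S : X → X) (g : X → ℝ) : ℕ → X → ℝ
  | 0 => fun _ => 0
  | n + 1 => fun x => max 0 (g x + maxBirkhoffSum S g n (S x))

theorem maxBirkhoffSum_nonneg (S : X → X) (g : X → ℝ) (n : ℕ) (x : X) :
    0 ≤ maxBirkhoffSum S g n x := by
  cases n with
  | zero => exact le_rfl
  | succ n => exact le_max_left _ _

theorem birkhoffSum_le_maxBirkhoffSum (S : X → X) (g : X → ℝ) (n : ℕ) (x : X) :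
    birkhoffSum S g n x ≤ maxBirkhoffSum S g n x := by
  induction n generalizing x with
  | zero => simp [maxBirkhoffSum]
  | succ n ih =>
    rw [birkhoffSum_succ']
    exact (add_le_add_right (ih (S x)) _).trans (le_max_right _ _)

theorem maxBirkhoffSum_le_succ (S : X → X) (g : X → ℝ) (n : ℕ) (x : X) :
    maxBirkhoffSum S g n x ≤ maxBirkhoffSum S g (n + 1) x := by
  induction n generalizing x with
  | zero => exact le_max_left _ _
  | succ n ih => exact max_le_max le_rfl (add_le_add_right (ih (S x)) _)

/-- The set where the running maxima of the Birkhoff sums are unbounded. -/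
def unboundedSet (S : X → X) (g : X → ℝ) : Set X :=
  {x | ∀ m : ℕ, ∃ n, (m : ℝ) < maxBirkhoffSum S g n x}

/-- By the recursion, passing from `x` to `S x` changes the maxima only by the finite amount `g x`,
a truncation at `0` and an index shift. -/
theorem preimage_unboundedSet (S : X → X) (g : X → ℝ) :
    S ⁻¹' unboundedSet S g = unboundedSet S g := by
  ext x
  constructor
  · intro h m
    obtain ⟨k, hk⟩ := exists_nat_gt ((m : ℝ) - g x)
    obtain ⟨n, hn⟩ := h k
    exact ⟨n + 1, lt_max_of_lt_right (by linarith)⟩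
  · intro h m
    obtain ⟨k, hk⟩ := exists_nat_gt ((m : ℝ) + g x)
    obtain ⟨n, hn⟩ := h k
    cases n with
    | zero => exact absurd hn (not_lt.2 k.cast_nonneg)
    | succ n =>
      rcases lt_max_iff.1 hn with h0 | h0
      · exact absurd h0 (not_lt.2 k.cast_nonneg)
      · exact ⟨n, by linarith⟩

theorem tendsto_maxBirkhoffSum {S : X → X} {g : X → ℝ} {x : X} (hx : x ∈ unboundedSet S g) :
    Tendsto (fun n => maxBirkhoffSum S g n x) atTop atTop :=
  tendsto_atTop_atTop_of_monotone (monotone_nat_of_le_succ fun n => maxBirkhoffSum_le_succ S g n x)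
    fun b => by
      obtain ⟨m, hm⟩ := exists_nat_ge b
      obtain ⟨n, hn⟩ := hx m
      exact ⟨n, hm.trans hn.le⟩

variable [MeasurableSpace X] {ν : Measure X} {S : X → X} {g : X → ℝ}

theorem measurable_maxBirkhoffSum (hS : Measurable S) (hg : Measurable g) (n : ℕ) :
    Measurable (maxBirkhoffSum S g n) := by
  induction n with
  | zero => exact measurable_const
  | succ n ih => exact measurable_const.max (hg.add (ih.comp hS))

theorem integrable_maxBirkhoffSum (hS : MeasurePreserving S ν ν) (hg : Integrable g ν) (n : ℕ) :
    Integrable (maxBirkhoffSum S g n) ν := by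
  induction n with
  | zero => exact integrable_zero _ _ _
  | succ n ih => exact (integrable_zero _ _ _).sup (hg.add (hS.integrable_comp_of_integrable ih))

theorem measurableSet_unboundedSet (hS : Measurable S) (hg : Measurable g) :
    MeasurableSet (unboundedSet S g) := by
  simp only [unboundedSet, Set.ofPred_forall, Set.ofPred_exists]
  exact MeasurableSet.iInter fun _ => MeasurableSet.iUnion fun n =>
    measurableSet_lt measurable_const (measurable_maxBirkhoffSum hS hg n)

/-- A form of the maximal ergodic theorem. -/
theorem setIntegral_unboundedSet_nonneg (hS : MeasurePreserving S ν ν) (hg : Measurable g)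
    (hgi : Integrable g ν) : 0 ≤ ∫ x in unboundedSet S g, g x ∂ν := by
  set A := unboundedSet S g with hA
  have hAm : MeasurableSet A := measurableSet_unboundedSet hS.measurable hg
  have hSA : MeasurePreserving S (ν.restrict A) (ν.restrict A) := by
    have h := hS.restrict_preimage hAm
    rwa [preimage_unboundedSet] at h
  have hgA : Integrable g (ν.restrict A) := hgi.restrict
  have hM := integrable_maxBirkhoffSum hSA hgA
  -- The integrand is `max (-Mₙ (S x)) (g x)`, dominated by `|g|`. It equals `g x` once `Mₙ (S x)`
  -- is large, which happens on `A`. As `S` preserves the restricted measure, its integral is that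
  -- of `Mₙ₊₁ - Mₙ ≥ 0`.
  have hlim : Tendsto
      (fun n => ∫ x, (maxBirkhoffSum S g (n + 1) x - maxBirkhoffSum S g n (S x)) ∂(ν.restrict A))
      atTop (𝓝 (∫ x in A, g x ∂ν)) := by
    have hdiff : ∀ n x, maxBirkhoffSum S g (n + 1) x - maxBirkhoffSum S g n (S x)
        = max (-maxBirkhoffSum S g n (S x)) (g x) := by
      intro n x
      simp only [maxBirkhoffSum]
      rw [← max_sub_sub_right]
      simp
    simp only [hdiff]
    refine tendsto_integral_of_dominated_convergence (fun x => |g x|)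
      (fun n => ?_) hgA.abs (fun n => ?_) ?_
    · exact (((measurable_maxBirkhoffSum hS.measurable hg n).comp hS.measurable).neg.max
        hg).aestronglyMeasurable
    · refine Eventually.of_forall fun x => ?_
      have h0 := maxBirkhoffSum_nonneg S g n (S x)
      rw [Real.norm_eq_abs, abs_le]
      refine ⟨(neg_abs_le _).trans (le_max_right _ _), max_le ?_ (le_abs_self _)⟩
      linarith [abs_nonneg (g x)]
    · filter_upwards [ae_restrict_mem hAm] with x hx
      have hx' : S x ∈ unboundedSet S g := by
        rw [← Set.mem_preimage, preimage_unboundedSet]; exact hx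
      refine tendsto_const_nhds.congr' ?_
      filter_upwards [(tendsto_maxBirkhoffSum hx').eventually_ge_atTop (-g x)] with n hn
      rw [max_eq_right]
      linarith
  refine ge_of_tendsto' hlim fun n => ?_
  have hcomp : ∫ x, maxBirkhoffSum S g n (S x) ∂(ν.restrict A)
      = ∫ x, maxBirkhoffSum S g n x ∂(ν.restrict A) := by
    conv_rhs => rw [← hSA.map_eq]
    rw [integral_map hSA.aemeasurable
      (measurable_maxBirkhoffSum hS.measurable hg n).aestronglyMeasurable]
  have hMS : Integrable (fun x => maxBirkhoffSum S g n (S x)) (ν.restrict A) :=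
    hSA.integrable_comp_of_integrable (hM n)
  rw [integral_sub (hM (n + 1)) hMS, hcomp, sub_nonneg]
  exact integral_mono (hM n) (hM (n + 1)) fun x => maxBirkhoffSum_le_succ S g n x

/-- The maximal theorem for `g - ε` on its invariant unbounded set `A` reads `0 ≤ -ε ν(A)`, so `A`
is null. -/
theorem ae_birkhoffSum_le [IsFiniteMeasure ν] (hS : MeasurePreserving S ν ν) (hg : Measurable g)
    (hgi : Integrable g ν)
    (h0 : ∀ B, MeasurableSet B → S ⁻¹' B = B → ∫ x in B, g x ∂ν = 0) {ε : ℝ} (hε : 0 < ε) :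
    ∀ᵐ x ∂ν, ∃ C : ℝ, ∀ n : ℕ, birkhoffSum S g n x ≤ C + n * ε := by
  set g' : X → ℝ := fun x => g x - ε with hg'
  have hg'm : Measurable g' := hg.sub_const ε
  have hAm := measurableSet_unboundedSet hS.measurable hg'm
  have h1 := setIntegral_unboundedSet_nonneg hS hg'm (hgi.sub (integrable_const ε))
  rw [integral_sub hgi.restrict (integrable_const ε), h0 _ hAm (preimage_unboundedSet S g'),
    setIntegral_const, smul_eq_mul, zero_sub] at h1
  have h2 : ν.real (unboundedSet S g') = 0 := by
    have : 0 ≤ ν.real (unboundedSet S g') := measureReal_nonneg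
    nlinarith
  rw [measureReal_eq_zero_iff] at h2
  filter_upwards [measure_eq_zero_iff_ae_notMem.1 h2] with x hx
  simp only [unboundedSet, Set.mem_ofPred_eq, not_forall, not_exists, not_lt] at hx
  obtain ⟨m, hm⟩ := hx
  refine ⟨m, fun n => ?_⟩
  have h3 := (birkhoffSum_le_maxBirkhoffSum S g' n x).trans (hm n)
  have h4 : birkhoffSum S g' n x = birkhoffSum S g n x - n * ε := by
    simp [birkhoffSum, hg', Finset.sum_sub_distrib]
  linarith

/-- Birkhoff's pointwise ergodic theorem for a function with zero mean on every invariant set. -/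
theorem ae_tendsto_birkhoffSum_div [IsFiniteMeasure ν] (hS : MeasurePreserving S ν ν)
    (hg : Measurable g) (hgi : Integrable g ν)
    (h0 : ∀ B, MeasurableSet B → S ⁻¹' B = B → ∫ x in B, g x ∂ν = 0) :
    ∀ᵐ x ∂ν, Tendsto (fun n : ℕ => birkhoffSum S g n x / n) atTop (𝓝 0) := by
  have hpos : ∀ k : ℕ, (0 : ℝ) < 1 / (k + 1) := fun k => Nat.one_div_pos_of_nat
  have hup := ae_all_iff.2 fun k : ℕ => ae_birkhoffSum_le hS hg hgi h0 (hpos k)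
  have hlow := ae_all_iff.2 fun k : ℕ => ae_birkhoffSum_le hS hg.neg hgi.neg
    (fun B hB hSB => by simp [integral_neg, h0 B hB hSB]) (hpos k)
  filter_upwards [hup, hlow] with x hx1 hx2
  rw [Metric.tendsto_atTop]
  intro δ hδ
  obtain ⟨k, hk⟩ := exists_nat_one_div_lt (half_pos hδ)
  obtain ⟨C1, h1⟩ := hx1 k
  obtain ⟨C2, h2⟩ := hx2 k
  -- Half of `δ` bounds the slope `1 / (k + 1)`; the other half absorbs the constants `C1`, `C2` for
  -- large `n`.
  obtain ⟨N, hN⟩ := exists_nat_gt (max C1 C2 / (δ / 2))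
  refine ⟨N + 1, fun n hn => ?_⟩
  have hn' : (N : ℝ) + 1 ≤ n := by exact_mod_cast hn
  have hn0 : (0 : ℝ) < n := by have : (0 : ℝ) ≤ N := N.cast_nonneg; linarith
  have hC : max C1 C2 < n * (δ / 2) := by
    rw [div_lt_iff₀ (half_pos hδ)] at hN
    nlinarith
  have hk' : (n : ℝ) * (1 / (k + 1)) ≤ n * (δ / 2) := by gcongr
  have h1' := h1 n
  have h2' := h2 n
  have hneg : birkhoffSum S (-g) n x = -birkhoffSum S g n x := by simp [birkhoffSum]
  rw [hneg] at h2'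
  have := le_max_left C1 C2
  have := le_max_right C1 C2
  rw [Real.dist_eq, sub_zero, abs_div, Nat.abs_cast, div_lt_iff₀ hn0, abs_lt]
  constructor <;> linarith

theorem ae_tendsto_birkhoffSum_div_complex [IsFiniteMeasure ν] {f : X → ℂ}
    (hS : MeasurePreserving S ν ν) (hf : Measurable f) (hfi : Integrable f ν)
    (h0 : ∀ B, MeasurableSet B → S ⁻¹' B = B → ∫ x in B, f x ∂ν = 0) :
    ∀ᵐ x ∂ν, Tendsto (fun n : ℕ => birkhoffSum S f n x / n) atTop (𝓝 0) := by
  have hre := ae_tendsto_birkhoffSum_div hS (Complex.measurable_re.comp hf) hfi.re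
    fun B hB hSB => by
      have h := setIntegral_re_add_im (𝕜 := ℂ) (i := B) (f := f) (μ := ν) hfi.integrableOn
      rw [h0 B hB hSB] at h
      simpa using congrArg Complex.re h
  have him := ae_tendsto_birkhoffSum_div hS (Complex.measurable_im.comp hf) hfi.im
    fun B hB hSB => by
      have h := setIntegral_re_add_im (𝕜 := ℂ) (i := B) (f := f) (μ := ν) hfi.integrableOn
      rw [h0 B hB hSB] at h
      simpa using congrArg Complex.im h
  filter_upwards [hre, him] with x h1 h2
  have h3 := ((Complex.continuous_ofReal.tendsto 0).comp h1).add
    (((Complex.continuous_ofReal.tendsto 0).comp h2).mul_const Complex.I)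
  simp only [Complex.ofReal_zero, zero_mul, add_zero] at h3
  refine h3.congr fun n => ?_
  simp only [Function.comp_apply, birkhoffSum, Complex.ofReal_div, Complex.ofReal_natCast,
    Complex.ofReal_sum]
  rw [div_mul_eq_mul_div, ← add_div, Finset.sum_mul, ← Finset.sum_add_distrib]
  simp only [Complex.re_add_im]

end Birkhoff

/-! ### Markov chains on path space and their shift-invariant events. -/

section MarkovPath
open ProbabilityTheory

variable {M : Type*} [MeasurableSpace M]

theorem measurableSet_eval (n : ℕ) {A : Set M} (hA : MeasurableSet A) :
    MeasurableSet {y : ℕ → M | y n ∈ A} :=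
  measurable_pi_apply n hA

/-- The one-step shift on paths. -/
def pathShift {M : Type*} (y : ℕ → M) : ℕ → M := fun i => y (i + 1)

theorem measurable_pathShift : Measurable (pathShift (M := M)) :=
  measurable_pi_lambda _ fun _ => measurable_pi_apply _

theorem pathShift_iterate {M : Type*} (n : ℕ) (y : ℕ → M) : pathShift^[n] y = fun i => y (i + n) := by
  induction n generalizing y with
  | zero => rfl
  | succ n ih =>
    rw [Function.iterate_succ_apply, ih]
    funext i
    simp only [pathShift]
    congr 1

/-- A law `m` on paths is Markov with respect to the one-step transition probabilities
`Q x {z | z 1 ∈ A}`. -/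
def IsMarkovPath (Q : Kernel M (ℕ → M)) (m : Measure (ℕ → M)) : Prop :=
  ∀ (n : ℕ) (C : Set (ℕ → M)), MeasurableSet[Filtration.piLE (X := fun _ : ℕ => M) n] C →
    ∀ A : Set M, MeasurableSet A →
      m (C ∩ {y | y (n + 1) ∈ A}) = ∫⁻ y in C, Q (y n) {z | z 1 ∈ A} ∂m

/-- `Q x` is the law of a Markov chain started at `x`, with transition probabilities read off
from `Q`. -/
structure IsMarkovPathKernel (Q : Kernel M (ℕ → M)) : Prop where
  start : ∀ x A, MeasurableSet A → Q x {y | y 0 ∈ A} = A.indicator (fun _ => 1) x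
  markov : ∀ x, IsMarkovPath Q (Q x)

theorem measurable_eval_piLE {i n : ℕ} (h : i ≤ n) :
    Measurable[Filtration.piLE (X := fun _ : ℕ => M) n] fun y : ℕ → M => y i := by
  have : (fun y : ℕ → M => y i)
      = (fun w : (j : Set.Iic n) → M => w ⟨i, h⟩) ∘ Preorder.restrictLe (π := fun _ => M) n := rfl
  rw [this]
  exact (measurable_pi_apply _).comp (comap_measurable _)

/-- Ensures that the limit in Lévy's theorem is the indicator itself. -/
theorem iSup_piLE : ⨆ n, Filtration.piLE (X := fun _ : ℕ => M) n = MeasurableSpace.pi := by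
  refine le_antisymm (iSup_le fun n => Filtration.le _ n) (iSup_le fun i => ?_)
  exact le_trans (measurable_eval_piLE le_rfl).comap_le
    (le_iSup (fun n => (Filtration.piLE (X := fun _ : ℕ => M) n : MeasurableSpace _)) i)

variable {Q : Kernel M (ℕ → M)} {m : Measure (ℕ → M)}

theorem measurableSet_of_piLE {n : ℕ} {C : Set (ℕ → M)}
    (hC : MeasurableSet[Filtration.piLE (X := fun _ : ℕ => M) n] C) : MeasurableSet C :=
  (Filtration.piLE (X := fun _ : ℕ => M)).le n C hC

/-- The Markov identity is linear in the law, so it survives averaging over the starting point. -/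
theorem IsMarkovPath.bind (hQ : IsMarkovPathKernel Q) (μ : Measure M) :
    IsMarkovPath Q (μ.bind Q) := by
  intro n C hC A hA
  have hCm := measurableSet_of_piLE hC
  have hQm : AEMeasurable Q μ := Q.measurable.aemeasurable
  have hE : MeasurableSet {z : ℕ → M | z 1 ∈ A} := measurableSet_eval 1 hA
  have hf : Measurable fun y : ℕ → M => Q (y n) {z | z 1 ∈ A} :=
    (Q.measurable_coe hE).comp (measurable_pi_apply n)
  rw [Measure.bind_apply (hCm.inter (measurableSet_eval (n + 1) hA)) hQm,
    ← lintegral_indicator hCm, Measure.lintegral_bind hQm (hf.indicator hCm).aemeasurable]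
  refine lintegral_congr fun x => ?_
  rw [lintegral_indicator hCm, hQ.markov x n C hC A hA]

/-- The Markov property for sets is an equality of measures on `M`, so it can be integrated against
any `φ`. -/
theorem IsMarkovPath.lintegral_eval_succ (hm : IsMarkovPath Q m) {n : ℕ}
    {C : Set (ℕ → M)} (hC : MeasurableSet[Filtration.piLE (X := fun _ : ℕ => M) n] C)
    {φ : M → ENNReal} (hφ : Measurable φ) :
    ∫⁻ y in C, φ (y (n + 1)) ∂m = ∫⁻ y in C, ∫⁻ z, φ (z 1) ∂(Q (y n)) ∂m := by
  have hCm := measurableSet_of_piLE hC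
  have hQ1 : Measurable fun x => (Q x).map fun z => z 1 :=
    (Measure.measurable_map _ (measurable_pi_apply 1)).comp Q.measurable
  have key : (m.restrict C).map (fun y => y (n + 1))
      = ((m.restrict C).map (fun y => y n)).bind fun x => (Q x).map fun z => z 1 := by
    ext A hA
    rw [Measure.map_apply (measurable_pi_apply _) hA, Measure.bind_apply hA hQ1.aemeasurable,
      lintegral_map (f := fun x => (Q x).map (fun z => z 1) A)
        ((Measure.measurable_coe hA).comp hQ1) (measurable_pi_apply n),
      Measure.restrict_apply (measurable_pi_apply (n + 1) hA), Set.inter_comm]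
    refine (hm n C hC A hA).trans (lintegral_congr fun y => ?_)
    rw [Measure.map_apply (measurable_pi_apply 1) hA]
    rfl
  rw [← lintegral_map (μ := m.restrict C) hφ (measurable_pi_apply (n + 1)), key,
    Measure.lintegral_bind hQ1.aemeasurable hφ.aemeasurable,
    lintegral_map (f := fun x => ∫⁻ w, φ w ∂((Q x).map fun z => z 1))
      ((Measure.measurable_lintegral hφ).comp hQ1) (measurable_pi_apply n)]
  refine lintegral_congr fun y => ?_
  rw [lintegral_map hφ (measurable_pi_apply 1)]

theorem measurableSet_box {B : ℕ → Set M} (hB : ∀ i, MeasurableSet (B i)) (r : ℕ) :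
    MeasurableSet {z : ℕ → M | ∀ i < r, z i ∈ B i} := by
  simp only [Set.ofPred_forall]
  exact MeasurableSet.iInter fun i => MeasurableSet.iInter fun _ => measurableSet_eval i (hB i)

/-- The Markov property for events of the form `z 0 ∈ B 0, …, z (r - 1) ∈ B (r - 1)`. -/
theorem IsMarkovPath.measure_inter_box [IsMarkovKernel Q] (hQ : IsMarkovPathKernel Q) (r : ℕ) :
    ∀ {m : Measure (ℕ → M)}, IsMarkovPath Q m → ∀ {n : ℕ} {C : Set (ℕ → M)},
      MeasurableSet[Filtration.piLE (X := fun _ : ℕ => M) n] C →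
      ∀ {B : ℕ → Set M}, (∀ i, MeasurableSet (B i)) →
      m (C ∩ {y | ∀ i < r, y (i + n) ∈ B i})
        = ∫⁻ y in C, Q (y n) {z | ∀ i < r, z i ∈ B i} ∂m := by
  induction r with
  | zero => intro m _ n C _ B _; simp
  | succ r ih =>
    intro m hm n C hC B hB
    set φ : M → ENNReal := fun x => Q x {z | ∀ i < r, z i ∈ B (i + 1)} with hφ
    have hφm : Measurable φ := Q.measurable_coe (measurableSet_box (fun i => hB (i + 1)) r)
    have hsplit : ∀ k : ℕ, {y : ℕ → M | ∀ i < r + 1, y (i + k) ∈ B i}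
        = {y | y k ∈ B 0} ∩ {y | ∀ i < r, y (i + (k + 1)) ∈ B (i + 1)} := by
      intro k
      ext y
      simp only [Set.mem_inter_iff, Set.mem_ofPred_eq]
      constructor
      · refine fun h => ⟨by simpa using h 0 (by omega), fun i hi => ?_⟩
        have := h (i + 1) (by omega)
        rwa [show i + 1 + k = i + (k + 1) by omega] at this
      · rintro ⟨h0, h1⟩ i hi
        cases i with
        | zero => simpa using h0
        | succ i =>
          have := h1 i (by omega)
          rwa [show i + (k + 1) = i + 1 + k by omega] at this
    have hmem : ∀ k : ℕ,
        MeasurableSet[Filtration.piLE (X := fun _ : ℕ => M) k] {y : ℕ → M | y k ∈ B 0} :=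
      fun k => measurable_eval_piLE le_rfl (hB 0)
    have hmono : ∀ k : ℕ, Filtration.piLE (X := fun _ : ℕ => M) k
        ≤ Filtration.piLE (X := fun _ : ℕ => M) (k + 1) :=
      fun k => (Filtration.piLE (X := fun _ : ℕ => M)).mono k.le_succ
    -- The induction hypothesis is applied to the law `Q x` itself, at time `1` with past event `{z
    -- 0 ∈ B 0}`. That event has `Q x`-measure `1` or `0` according to whether `x ∈ B 0`.
    have hright : ∀ x, Q x {z | ∀ i < r + 1, z i ∈ B i}
        = (B 0).indicator (fun x => ∫⁻ z, φ (z 1) ∂(Q x)) x := by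
      intro x
      have h1 := hsplit 0
      simp only [add_zero, zero_add] at h1
      rw [h1, ih (hQ.markov x) (n := 1) (hmono 0 _ (hmem 0)) (fun i => hB (i + 1))]
      have hs := hQ.start x (B 0) (hB 0)
      by_cases hx : x ∈ B 0
      · rw [Set.indicator_of_mem hx] at hs ⊢
        rw [Measure.restrict_eq_self_of_ae_mem]
        exact (prob_compl_eq_zero_iff (measurableSet_eval 0 (hB 0))).2 hs
      · rw [Set.indicator_of_notMem hx] at hs ⊢
        exact setLIntegral_measure_zero _ _ hs
    rw [hsplit n, ← Set.inter_assoc,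
      ih hm (n := n + 1) (hmono n _ (hC.inter (hmem n))) (fun i => hB (i + 1))]
    change ∫⁻ y in C ∩ {y | y n ∈ B 0}, φ (y (n + 1)) ∂m = _
    rw [hm.lintegral_eval_succ (hC.inter (hmem n)) hφm]
    simp only [hright]
    rw [Set.inter_comm, ← Measure.restrict_restrict (measurableSet_eval n (hB 0)),
      ← lintegral_indicator (measurableSet_eval n (hB 0))]
    rfl

/-- The Markov property for arbitrary events of the future. -/
theorem IsMarkovPath.measure_inter_preimage [IsMarkovKernel Q] (hQ : IsMarkovPathKernel Q)
    [IsFiniteMeasure m] (hm : IsMarkovPath Q m) {n : ℕ} {C : Set (ℕ → M)}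
    (hC : MeasurableSet[Filtration.piLE (X := fun _ : ℕ => M) n] C) {B : Set (ℕ → M)}
    (hB : MeasurableSet B) :
    m (C ∩ pathShift^[n] ⁻¹' B) = ∫⁻ y in C, Q (y n) B ∂m := by
  classical
  have hSn : Measurable (pathShift (M := M))^[n] := measurable_pathShift.iterate n
  have hQm : AEMeasurable Q ((m.restrict C).map fun y => y n) := Q.measurable.aemeasurable
  have hR : ∀ {E : Set (ℕ → M)}, MeasurableSet E →
      ((m.restrict C).map fun y => y n).bind Q E = ∫⁻ y in C, Q (y n) E ∂m := fun {E} hE => by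
    rw [Measure.bind_apply hE hQm, lintegral_map (Q.measurable_coe hE) (measurable_pi_apply n)]
  have hL : ∀ {E : Set (ℕ → M)}, MeasurableSet E →
      (m.restrict C).map pathShift^[n] E = m (C ∩ pathShift^[n] ⁻¹' E) := fun {E} hE => by
    rw [Measure.map_apply hSn hE, Measure.restrict_apply (hSn hE), Set.inter_comm]
  rw [← hL hB, ← hR hB]
  congr 1
  refine ext_of_generate_finite _ generateFrom_squareCylinders.symm
    (isPiSystem_squareCylinders (fun _ => MeasurableSpace.isPiSystem_measurableSet)
      fun _ => MeasurableSet.univ) ?_ ?_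
  · rintro E ⟨s, t, ht, rfl⟩
    have ht' : ∀ i, MeasurableSet (t i) := fun i => ht i (Set.mem_univ i)
    obtain ⟨r, hr⟩ := s.exists_nat_subset_range
    -- Padding with `Set.univ` turns a finite set of constrained times into an initial segment.
    have hbox : (s : Set ℕ).pi t
        = {z : ℕ → M | ∀ i < r, z i ∈ if i ∈ s then t i else Set.univ} := by
      ext z
      simp only [Set.mem_pi, Finset.mem_coe, Set.mem_ofPred_eq]
      constructor
      · intro h i _
        split_ifs with hi
        · exact h i hi
        · trivial
      · intro h i hi
        simpa [hi] using h i (Finset.mem_range.1 (hr hi))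
    have hBm : ∀ i, MeasurableSet (if i ∈ s then t i else Set.univ) := fun i => by
      split_ifs
      · exact ht' i
      · exact MeasurableSet.univ
    rw [hbox, hL (measurableSet_box hBm r), hR (measurableSet_box hBm r),
      ← IsMarkovPath.measure_inter_box hQ r hm hC hBm]
    congr 2
    ext y
    simp [pathShift_iterate]
  · rw [hL MeasurableSet.univ, hR MeasurableSet.univ]
    simp

variable {μ : Measure M}

theorem map_eval_zero_bind [IsMarkovKernel Q] (hQ : IsMarkovPathKernel Q) :
    (μ.bind Q).map (fun y => y 0) = μ := by
  ext A hA
  rw [Measure.map_apply (measurable_pi_apply 0) hA,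
    Measure.bind_apply (measurable_pi_apply 0 hA) Q.measurable.aemeasurable]
  calc _ = ∫⁻ x, A.indicator (fun _ => 1) x ∂μ := lintegral_congr fun x => hQ.start x A hA
    _ = μ A := by simp [lintegral_indicator hA]

instance [IsProbabilityMeasure μ] [IsMarkovKernel Q] : IsProbabilityMeasure (μ.bind Q) :=
  ⟨by rw [Measure.bind_apply MeasurableSet.univ Q.measurable.aemeasurable]; simp⟩

/-- The shift preserves the law of a Markov chain started from an invariant distribution. -/
theorem measurePreserving_pathShift [IsProbabilityMeasure μ] [IsMarkovKernel Q]
    (hQ : IsMarkovPathKernel Q)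
    (hμ : ∀ A, MeasurableSet A → ∫⁻ x, Q x {z | z 1 ∈ A} ∂μ = μ A) :
    MeasurePreserving pathShift (μ.bind Q) (μ.bind Q) := by
  refine ⟨measurable_pathShift, ?_⟩
  have hQm : AEMeasurable Q μ := Q.measurable.aemeasurable
  have h1 : (μ.bind Q).map (fun y => y 1) = μ := by
    ext A hA
    rw [Measure.map_apply (measurable_pi_apply 1) hA,
      Measure.bind_apply (measurable_pi_apply 1 hA) hQm]
    exact hμ A hA
  ext B hB
  rw [Measure.map_apply measurable_pathShift hB]
  -- The Markov property at time `1` with trivial past; `y 1` has law `μ` by invariance.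
  have h2 := (IsMarkovPath.bind hQ μ).measure_inter_preimage hQ (n := 1) MeasurableSet.univ hB
  rw [Set.univ_inter, Function.iterate_one, Measure.restrict_univ,
    ← lintegral_map (Q.measurable_coe hB) (measurable_pi_apply 1), h1] at h2
  rw [h2, Measure.bind_apply hB hQm]

/-- A shift-invariant event of a stationary Markov chain is determined by the starting point. -/
theorem ae_eq_preimage_eval_zero_of_invariant [IsProbabilityMeasure μ] [IsMarkovKernel Q]
    (hQ : IsMarkovPathKernel Q)
    (hμ : ∀ A, MeasurableSet A → ∫⁻ x, Q x {z | z 1 ∈ A} ∂μ = μ A)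
    {B : Set (ℕ → M)} (hB : MeasurableSet B) (hSB : pathShift ⁻¹' B = B) :
    ∀ᵐ y ∂(μ.bind Q), y ∈ B ↔ y 0 ∈ {x | (Q x).real B = 1} := by
  set ν := μ.bind Q with hν
  set h : M → ℝ := fun x => (Q x).real B with hh
  have hhm : Measurable h := (Q.measurable_coe hB).ennreal_toReal
  have hSn : ∀ n, pathShift^[n] ⁻¹' B = B := fun n => by
    induction n with
    | zero => rfl
    | succ n ih => rw [Function.iterate_succ, Set.preimage_comp, ih, hSB]
  have hint : Integrable (B.indicator fun _ => (1 : ℝ)) ν := (integrable_const 1).indicator hB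
  have hhint : ∀ n, Integrable (fun y : ℕ → M => h (y n)) ν := fun n =>
    Integrable.of_bound (hhm.comp (measurable_pi_apply n)).aestronglyMeasurable 1
      (Eventually.of_forall fun y => by
        rw [Real.norm_eq_abs, abs_of_nonneg measureReal_nonneg]; exact measureReal_le_one)
  -- As `B` is its own preimage under the `n`-fold shift, the Markov property at time `n` gives this
  -- conditional probability.
  have hcond : ∀ n, (fun y : ℕ → M => h (y n))
      =ᵐ[ν] ν[B.indicator fun _ => (1 : ℝ) | Filtration.piLE (X := fun _ : ℕ => M) n] := by
    intro n
    refine ae_eq_condExp_of_forall_setIntegral_eq (Filtration.le _ n) hint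
      (fun s _ _ => (hhint n).integrableOn) (fun s hs _ => ?_) ?_
    · rw [setIntegral_indicator hB, setIntegral_const, smul_eq_mul, mul_one]
      have h1 := (IsMarkovPath.bind hQ μ).measure_inter_preimage hQ hs hB
      rw [hSn n] at h1
      rw [Measure.real, h1]
      exact integral_toReal ((Q.measurable_coe hB).comp (measurable_pi_apply n)).aemeasurable
        (Eventually.of_forall fun y => measure_lt_top _ _)
    · exact (hhm.comp (measurable_eval_piLE le_rfl)).stronglyMeasurable.aestronglyMeasurable
  have htop : ν[B.indicator fun _ => (1 : ℝ) | ⨆ n, Filtration.piLE (X := fun _ : ℕ => M) n]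
      = B.indicator fun _ => (1 : ℝ) := by
    rw [iSup_piLE]
    exact condExp_of_stronglyMeasurable le_rfl
      (stronglyMeasurable_const.indicator hB) hint
  have hlim := tendsto_eLpNorm_condExp (μ := ν) (ℱ := Filtration.piLE (X := fun _ : ℕ => M))
    (B.indicator fun _ => (1 : ℝ))
  rw [htop] at hlim
  have hS := measurePreserving_pathShift hQ hμ
  set u : (ℕ → M) → ℝ := fun y => h (y 0) - B.indicator (fun _ => (1 : ℝ)) y with hu
  have hum : Measurable u :=
    (hhm.comp (measurable_pi_apply 0)).sub (measurable_const.indicator hB)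
  -- By shift-invariance of `B`, composing `u` with the `n`-fold shift gives `h (y n) - 1_B`, and
  -- the shift preserves `ν`. A constant sequence tending to `0` then forces `u = 0` a.e.
  have hconst : ∀ n, eLpNorm (ν[B.indicator fun _ => (1 : ℝ) |
      Filtration.piLE (X := fun _ : ℕ => M) n] - B.indicator fun _ => (1 : ℝ)) 1 ν
      = eLpNorm u 1 ν := by
    intro n
    rw [← eLpNorm_comp_measurePreserving hum.aestronglyMeasurable (hS.iterate n)]
    refine eLpNorm_congr_ae ?_
    filter_upwards [hcond n] with y hy
    rw [Pi.sub_apply, ← hy, Function.comp_apply, hu]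
    have h3 : pathShift^[n] y ∈ B ↔ y ∈ B := by
      rw [← Set.mem_preimage, hSn n]
    have h4 : pathShift^[n] y 0 = y n := by rw [pathShift_iterate]; simp
    by_cases hy : y ∈ B <;> simp [h3, h4, hy]
  simp only [hconst] at hlim
  have hzero := tendsto_nhds_unique tendsto_const_nhds hlim
  rw [eLpNorm_eq_zero_iff hum.aestronglyMeasurable one_ne_zero] at hzero
  filter_upwards [hzero] with y hy
  simp only [hu, Pi.zero_apply] at hy
  by_cases hyB : y ∈ B
  · simp only [hyB, Set.indicator_of_mem, true_iff] at hy ⊢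
    exact sub_eq_zero.1 hy
  · simp only [hyB, not_false_eq_true, Set.indicator_of_notMem, sub_zero, false_iff] at hy ⊢
    simp only [hh] at hy
    rw [hy]
    exact zero_ne_one

end MarkovPath

/-! ### Trajectories of the random dynamical system as a stationary Markov chain. -/

namespace RandomDynamicalSystem
open ProbabilityTheory

variable {𝕋 M Ω : Type*} [CommSemiring 𝕋] [LinearOrder 𝕋] [MeasurableSpace 𝕋]
  [MeasurableSpace M] [MeasurableSpace Ω] {P : Measure Ω} (D : RandomDynamicalSystem 𝕋 M P)

/-- The trajectory `n ↦ T_ω^n x` at the times `0, 1, 2, …`. -/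
def trajectory (x : M) (ω : Ω) : ℕ → M := fun n => D.T ω (n : 𝕋) x

theorem measurable_trajectory : Measurable fun p : M × Ω => D.trajectory p.1 p.2 :=
  measurable_pi_lambda _ fun n => D.measurable_map (n : 𝕋)

theorem measurable_trajectory_right (x : M) : Measurable (D.trajectory x) :=
  D.measurable_trajectory.comp measurable_prodMk_left

theorem past_le (x : M) (s : 𝕋) : D.past x s ≤ ‹MeasurableSpace Ω› :=
  iSup₂_le fun r _ => ((D.measurable_map r).comp measurable_prodMk_left).comap_le

theorem measurableSet_past_preimage_trajectory [IsStrictOrderedRing 𝕋] (x : M) (n : ℕ)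
    {C : Set (ℕ → M)} (hC : MeasurableSet[Filtration.piLE (X := fun _ : ℕ => M) n] C) :
    MeasurableSet[D.past x (n : 𝕋)] (D.trajectory x ⁻¹' C) := by
  obtain ⟨E, hE, rfl⟩ := hC
  have h : Measurable[D.past x (n : 𝕋)] fun ω =>
      Preorder.restrictLe (π := fun _ : ℕ => M) n (D.trajectory x ω) := by
    refine @measurable_pi_lambda _ _ _ (D.past x (n : 𝕋)) _ _ fun i => ?_
    have hi : ((i : ℕ) : 𝕋) ∈ Set.Icc (0 : 𝕋) n :=
      ⟨Nat.cast_nonneg _, Nat.cast_le.2 i.2⟩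
    exact Measurable.mono (comap_measurable fun ω => D.T ω ((i : ℕ) : 𝕋) x)
      (le_iSup₂_of_le _ hi le_rfl) le_rfl
  exact h hE

/-- The law of the trajectory as a kernel of the starting point. -/
noncomputable def pathKernel [IsProbabilityMeasure P] : Kernel M (ℕ → M) where
  toFun x := P.map (D.trajectory x)
  measurable' := Measure.measurable_of_measurable_coe _ fun B hB => by
    simp only [Measure.map_apply (D.measurable_trajectory_right _) hB]
    exact measurable_measure_prodMk_left (ν := P) (D.measurable_trajectory hB)

variable [IsProbabilityMeasure P]

theorem pathKernel_apply (x : M) {B : Set (ℕ → M)} (hB : MeasurableSet B) :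
    D.pathKernel x B = P (D.trajectory x ⁻¹' B) :=
  Measure.map_apply (D.measurable_trajectory_right x) hB

instance : IsMarkovKernel D.pathKernel :=
  ⟨fun x => Measure.isProbabilityMeasure_map (D.measurable_trajectory_right x).aemeasurable⟩

theorem bind_pathKernel (μ : Measure M) [IsProbabilityMeasure μ] :
    μ.bind D.pathKernel = (μ.prod P).map fun p => D.trajectory p.1 p.2 := by
  ext B hB
  rw [Measure.bind_apply hB D.pathKernel.measurable.aemeasurable,
    Measure.map_apply D.measurable_trajectory hB, Measure.prod_apply (D.measurable_trajectory hB)]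
  exact lintegral_congr fun x => D.pathKernel_apply x hB

variable {D}

/-- The conditional probability for `s = n`, `t = 1` is integrated over the past event `C'`;
finiteness converts the real identity to `ENNReal`. -/
theorem IsMarkovFamily.isMarkovPathKernel [IsStrictOrderedRing 𝕋] (hD : D.IsMarkovFamily) :
    IsMarkovPathKernel D.pathKernel where
  start x A hA := by
    rw [D.pathKernel_apply x (measurableSet_eval 0 hA)]
    by_cases hx : x ∈ A <;>
      simp [trajectory, D.T_zero, hx, Set.preimage]
  markov x n C hC A hA := by
    have hCm := measurableSet_of_piLE hC
    have hX := D.measurable_trajectory_right x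
    set C' := D.trajectory x ⁻¹' C with hC'
    have hC'm : MeasurableSet C' := hX hCm
    have hE : MeasurableSet {z : ℕ → M | z 1 ∈ A} := measurableSet_eval 1 hA
    have hA' : MeasurableSet {ω | D.T ω ((n : 𝕋) + 1) x ∈ A} :=
      ((D.measurable_map _).comp measurable_prodMk_left) hA
    have hQ : ∀ y, D.pathKernel y {z | z 1 ∈ A} = P {ω | D.T ω (1 : 𝕋) y ∈ A} := fun y => by
      rw [D.pathKernel_apply y hE]
      simp [trajectory, Set.preimage]
    have hQm : Measurable fun y => P {ω | D.T ω (1 : 𝕋) y ∈ A} := by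
      simp only [← hQ]
      exact D.pathKernel.measurable_coe hE
    have h1 := setIntegral_condExp (μ := P) (D.past_le x (n : 𝕋))
      ((integrable_const (1 : ℝ)).indicator hA') (D.measurableSet_past_preimage_trajectory x n hC)
    rw [setIntegral_congr_ae (g := fun ω => D.transitionProb (D.T ω (n : 𝕋) x) A 1) hC'm
      ((hD x n 1 (Nat.cast_nonneg _) zero_le_one A hA).mono fun ω hω _ => hω),
      setIntegral_indicator hA', setIntegral_const, smul_eq_mul, mul_one] at h1
    have hm' : Measurable fun ω => P {ω' | D.T ω' (1 : 𝕋) (D.T ω (n : 𝕋) x) ∈ A} :=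
      hQm.comp ((D.measurable_map _).comp measurable_prodMk_left)
    have h2 : (∫⁻ ω in C', P {ω' | D.T ω' (1 : 𝕋) (D.T ω (n : 𝕋) x) ∈ A} ∂P).toReal
        = (P (C' ∩ {ω | D.T ω ((n : 𝕋) + 1) x ∈ A})).toReal := by
      rw [← integral_toReal hm'.aemeasurable (Eventually.of_forall fun _ => measure_lt_top _ _)]
      exact h1
    have hfin : ∫⁻ ω in C', P {ω' | D.T ω' (1 : 𝕋) (D.T ω (n : 𝕋) x) ∈ A} ∂P ≠ ⊤ := by
      refine ne_top_of_le_ne_top (measure_ne_top P C') ?_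
      calc _ ≤ ∫⁻ _ in C', 1 ∂P := lintegral_mono fun _ => prob_le_one
        _ = P C' := by simp
    rw [ENNReal.toReal_eq_toReal_iff' hfin (measure_ne_top _ _)] at h2
    have hf : Measurable fun y : ℕ → M => P {ω | D.T ω (1 : 𝕋) (y n) ∈ A} :=
      hQm.comp (measurable_pi_apply n)
    simp only [hQ]
    rw [D.pathKernel_apply x (hCm.inter (measurableSet_eval (n + 1) hA))]
    change _ = ∫⁻ y in C, P {ω | D.T ω (1 : 𝕋) (y n) ∈ A} ∂(P.map (D.trajectory x))
    rw [setLIntegral_map hCm hf hX]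
    refine Eq.trans ?_ h2.symm
    congr 1
    ext ω
    simp [trajectory, hC']

theorem IsInvariantMeasure.lintegral_pathKernel [IsStrictOrderedRing 𝕋] {μ : Measure M}
    [IsProbabilityMeasure μ] (hD : D.IsInvariantMeasure μ) (A : Set M) (hA : MeasurableSet A) :
    ∫⁻ x, D.pathKernel x {z | z 1 ∈ A} ∂μ = μ A := by
  have hE : MeasurableSet {p : M × Ω | D.T p.2 (1 : 𝕋) p.1 ∈ A} := D.measurable_map 1 hA
  have h1 := Measure.prod_apply (μ := μ) (ν := P) hE
  rw [Measure.prod_apply_symm hE] at h1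
  have h2 := hD 1 zero_le_one A hA
  calc _ = ∫⁻ x, P (Prod.mk x ⁻¹' {p : M × Ω | D.T p.2 (1 : 𝕋) p.1 ∈ A}) ∂μ :=
        lintegral_congr fun x => by
          rw [D.pathKernel_apply x (measurableSet_eval 1 hA)]
          simp [trajectory, Set.preimage]
    _ = μ A := h1.symm.trans h2

variable (D) in
-- Reads the integral defining invariant sets as a path probability.
theorem measure_eval_zero_inter_eval (μ : Measure M) [IsProbabilityMeasure μ] (n : ℕ) {A : Set M}
    (hA : MeasurableSet A) :
    (μ.bind D.pathKernel) ({y | y 0 ∈ A} ∩ {y | y n ∈ A})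
      = ∫⁻ x in A, ∫⁻ ω, A.indicator (fun _ => 1) (D.T ω (n : 𝕋) x) ∂P ∂μ := by
  have h0 : MeasurableSet {y : ℕ → M | y 0 ∈ A} := measurableSet_eval 0 hA
  have hn : MeasurableSet {y : ℕ → M | y n ∈ A} := measurableSet_eval n hA
  rw [Measure.bind_apply (h0.inter hn) D.pathKernel.measurable.aemeasurable,
    ← lintegral_indicator hA]
  refine lintegral_congr fun x => ?_
  rw [D.pathKernel_apply x (h0.inter hn)]
  have hω : MeasurableSet {ω | D.T ω (n : 𝕋) x ∈ A} :=
    ((D.measurable_map _).comp measurable_prodMk_left) hA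
  by_cases hx : x ∈ A
  · rw [Set.indicator_of_mem hx]
    have h := lintegral_indicator_one (μ := P) hω
    rw [show D.trajectory x ⁻¹' ({y | y 0 ∈ A} ∩ {y | y n ∈ A}) = {ω | D.T ω (n : 𝕋) x ∈ A} by
      ext ω; simp [trajectory, D.T_zero, hx], ← h]
    rfl
  · rw [Set.indicator_of_notMem hx]
    convert measure_empty (μ := P)
    ext ω
    simp [trajectory, D.T_zero, hx]

variable {μ : Measure M} [IsProbabilityMeasure μ]

/-- Invariant sets are null or of full measure, so the constant mean has the right integral over
each. -/
theorem IsErgodic.condExp_ae_eq (hD : D.IsStationary μ) (hE : D.IsErgodic μ) {f : M → ℂ}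
    (hf : Integrable f μ) :
    ∀ᵐ x ∂μ, (μ[f | D.invariantSigmaAlgebra μ hD]) x = ∫ x, f x ∂μ := by
  have hI := D.invariantSigmaAlgebra_le μ hD
  have h : (fun _ => ∫ x, f x ∂μ) =ᵐ[μ] μ[f | D.invariantSigmaAlgebra μ hD] := by
    refine ae_eq_condExp_of_forall_setIntegral_eq hI hf
      (fun s _ _ => (integrable_const _).integrableOn) (fun s hs _ => ?_)
      aestronglyMeasurable_const
    rcases hE s hs with h0 | h1
    · rw [setIntegral_measure_zero _ h0, setIntegral_measure_zero _ h0]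
    · have : μ.restrict s = μ :=
        Measure.restrict_eq_self_of_ae_mem ((prob_compl_eq_zero_iff hs.1).2 h1)
      rw [this]
      simp
  exact h.symm

variable [IsStrictOrderedRing 𝕋]

theorem measure_eval_zero (hD : D.IsStationary μ) {A : Set M} (hA : MeasurableSet A) :
    (μ.bind D.pathKernel) {y | y 0 ∈ A} = μ A := by
  have h := map_eval_zero_bind (μ := μ) hD.markov.isMarkovPathKernel
  conv_rhs => rw [← h, Measure.map_apply (measurable_pi_apply 0) hA]
  rfl

/-- Invariance says that `{y 0 ∈ A, y n ∈ A}` has the same measure as `{y 0 ∈ A}`, so a.e. path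
starting in `A` is in `A` at time `n`. Applying this to `Aᶜ` gives the converse. -/
theorem IsInvariantSet.ae_mem_iff (hD : D.IsStationary μ) {A : Set M} (hA : D.IsInvariantSet μ A)
    (n : ℕ) : ∀ᵐ y ∂(μ.bind D.pathKernel), y n ∈ A ↔ y 0 ∈ A := by
  have key : ∀ {A : Set M}, D.IsInvariantSet μ A →
      ∀ᵐ y ∂(μ.bind D.pathKernel), y 0 ∈ A → y n ∈ A := fun {A} hA => by
    have h0 : MeasurableSet {y : ℕ → M | y 0 ∈ A} := measurableSet_eval 0 hA.1
    have hn : MeasurableSet {y : ℕ → M | y n ∈ A} := measurableSet_eval n hA.1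
    have h1 := D.measure_eval_zero_inter_eval μ n hA.1
    rw [hA.2 n (Nat.cast_nonneg _), ← measure_eval_zero hD hA.1] at h1
    have h2 := ae_eq_of_subset_of_measure_ge Set.inter_subset_left h1.ge
      (h0.inter hn).nullMeasurableSet (measure_ne_top _ _)
    filter_upwards [h2.mem_iff] with y hy h
    exact (hy.2 h).2
  filter_upwards [key hA, key (hA.compl hD)] with y h1 h2
  exact ⟨fun h => by_contra fun h' => h2 h' h, h1⟩

/-- A shift-invariant event is, up to a null set, that of starting in some invariant set. -/
theorem exists_isInvariantSet_of_pathShift_invariant (h𝕋 : IsDiscreteTime 𝕋)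
    (hD : D.IsStationary μ) {B : Set (ℕ → M)} (hB : MeasurableSet B)
    (hSB : pathShift ⁻¹' B = B) :
    ∃ A, D.IsInvariantSet μ A ∧ B =ᵐ[μ.bind D.pathKernel] {y | y 0 ∈ A} := by
  have hQ := hD.markov.isMarkovPathKernel
  have hS := measurePreserving_pathShift hQ hD.invariant.lintegral_pathKernel
  have hae := ae_eq_preimage_eval_zero_of_invariant hQ hD.invariant.lintegral_pathKernel hB hSB
  set A := {x | (D.pathKernel x).real B = 1} with hA
  have hAm : MeasurableSet A :=
    measurableSet_eq_fun (D.pathKernel.measurable_coe hB).ennreal_toReal measurable_const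
  refine ⟨A, ⟨hAm, fun t ht => ?_⟩, eventuallyEq_set.2 hae⟩
  obtain ⟨n, rfl⟩ := h𝕋 t ht
  rw [← D.measure_eval_zero_inter_eval μ n hAm, ← measure_eval_zero hD hAm]
  have hSn : pathShift^[n] ⁻¹' B = B := by
    clear * - hSB
    induction n with
    | zero => rfl
    | succ n ih => rw [Function.iterate_succ, Set.preimage_comp, ih, hSB]
  -- Applying the a.e. equivalence at `y` and at its `n`-fold shift shows that `y 0 ∈ A`, `y ∈ B`
  -- and `y n ∈ A` agree a.e.
  refine measure_congr (eventuallyEq_set.2 ?_)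
  filter_upwards [hae, (hS.iterate n).quasiMeasurePreserving.ae hae] with y h1 h2
  rw [← Set.mem_preimage, hSn, pathShift_iterate] at h2
  simp only [zero_add] at h2
  exact ⟨fun h => h.1, fun h => ⟨h, h2.1 (h1.2 h)⟩⟩

/-- The pointwise ergodic theorem on path space. -/
theorem ae_tendsto_birkhoffSum_path (h𝕋 : IsDiscreteTime 𝕋) (hD : D.IsStationary μ)
    {F : (ℕ → M) → ℂ} (hF : Measurable F)
    (hFi : Integrable (fun p : M × Ω => F (D.trajectory p.1 p.2)) (μ.prod P)) :
    ∀ᵐ y ∂(μ.bind D.pathKernel), Tendsto (fun n : ℕ => birkhoffSum pathShift F n y / n) atTop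
      (𝓝 ((μ[fun x => ∫ ω, F (D.trajectory x ω) ∂P | D.invariantSigmaAlgebra μ hD]) (y 0))) := by
  have hQ := hD.markov.isMarkovPathKernel
  have hS := measurePreserving_pathShift hQ hD.invariant.lintegral_pathKernel
  have hI := D.invariantSigmaAlgebra_le μ hD
  have hmap0 := map_eval_zero_bind (μ := μ) hQ
  set ν := μ.bind D.pathKernel with hν
  have hνΦ : ν = (μ.prod P).map fun p => D.trajectory p.1 p.2 := D.bind_pathKernel μ
  set fbar : M → ℂ := fun x => ∫ ω, F (D.trajectory x ω) ∂P with hfbar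
  have hfbari : Integrable fbar μ := hFi.integral_prod_left
  set c : M → ℂ := μ[fbar | D.invariantSigmaAlgebra μ hD] with hc
  have hcI : Measurable[D.invariantSigmaAlgebra μ hD] c := stronglyMeasurable_condExp.measurable
  have hcm : Measurable c := hcI.mono hI le_rfl
  have hci : Integrable c μ := integrable_condExp
  have hFν : Integrable F ν := by
    rw [hνΦ]
    exact (integrable_map_measure hF.aestronglyMeasurable
      D.measurable_trajectory.aemeasurable).2 hFi
  have hcν : Integrable (fun y : ℕ → M => c (y 0)) ν := by
    rw [← hmap0] at hci
    exact hci.comp_measurable (measurable_pi_apply 0)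
  -- Equality of `c (y n)` and `c (y 0)` is tested on countably many measurable sets separating
  -- points of `ℂ`, whose preimages under `c` are invariant.
  have hcinv : ∀ᵐ y ∂ν, ∀ n : ℕ, c (y n) = c (y 0) :=
    ae_all_iff.2 fun n => Filter.EventuallyEq.of_forall_separating_mem_iff MeasurableSet
      fun U hU => IsInvariantSet.ae_mem_iff hD (hcI hU) n
  have hmean : ∀ B, MeasurableSet B → pathShift ⁻¹' B = B →
      ∫ y in B, (F y - c (y 0)) ∂ν = 0 := by
    intro B hB hSB
    obtain ⟨A, hA, hBA⟩ := exists_isInvariantSet_of_pathShift_invariant h𝕋 hD hB hSB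
    have hE : MeasurableSet {y : ℕ → M | y 0 ∈ A} := measurableSet_eval 0 hA.1
    rw [setIntegral_congr_set hBA, integral_sub hFν.integrableOn hcν.integrableOn, sub_eq_zero]
    have h1 : ∫ y in {y | y 0 ∈ A}, F y ∂ν = ∫ x in A, fbar x ∂μ := by
      rw [hνΦ, setIntegral_map hE hF.aestronglyMeasurable
        D.measurable_trajectory.aemeasurable]
      have hpre : (fun p : M × Ω => D.trajectory p.1 p.2) ⁻¹' {y | y 0 ∈ A}
          = A ×ˢ Set.univ := by
        ext p
        simp [trajectory, D.T_zero]
      rw [hpre, setIntegral_prod _ hFi.integrableOn, Measure.restrict_univ]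
    have h2 : ∫ y in {y | y 0 ∈ A}, c (y 0) ∂ν = ∫ x in A, c x ∂μ := by
      conv_rhs => rw [← hmap0]
      rw [setIntegral_map hA.1 hcm.aestronglyMeasurable (measurable_pi_apply 0).aemeasurable]
      rfl
    rw [h1, h2, hc, setIntegral_condExp hI hfbari hA]
  have hlim := ae_tendsto_birkhoffSum_div_complex hS
    (hF.sub (hcm.comp (measurable_pi_apply 0))) (hFν.sub hcν) hmean
  filter_upwards [hlim, hcinv] with y hy hcy
  have h3 := hy.add_const (c (y 0))
  rw [zero_add] at h3
  refine h3.congr' ?_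
  -- At `n = 0` the quotient is `0` by convention, so subtracting `c` from each term does not lower
  -- it by `c (y 0)`.
  filter_upwards [eventually_ne_atTop 0] with n hn
  have hn' : (n : ℂ) ≠ 0 := Nat.cast_ne_zero.2 hn
  simp only [birkhoffSum, Pi.sub_apply, Function.comp_apply, pathShift_iterate, zero_add, hcy,
    Finset.sum_sub_distrib, Finset.sum_const, Finset.card_range, nsmul_eq_mul]
  field_simp
  ring

end RandomDynamicalSystem

/-! ### The random ergodic theorem. -/

theorem mainTheorem5 {𝕋 M Ω : Type*} [CommSemiring 𝕋] [LinearOrder 𝕋] [IsStrictOrderedRing 𝕋]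
    [MeasurableSpace 𝕋] (h𝕋 : IsDiscreteTime 𝕋) [mM : MeasurableSpace M] [MeasurableSpace Ω]
    (P : Measure Ω) [IsProbabilityMeasure P] (μ : Measure M) [IsProbabilityMeasure μ]
    (D : RandomDynamicalSystem 𝕋 M P) (hD : D.IsStationary μ)
    (k : ℕ) (t : Fin k → 𝕋) (ht : ∀ i, 0 ≤ t i)
    (fhat : (Fin k → M) → ℂ) (hfhat : Measurable fhat)
    (hint : Integrable (fun p : M × Ω => D.multiTime t fhat p.1 p.2) (μ.prod P)) :
    (∀ᵐ p ∂(μ.prod P),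
      Tendsto (fun n : ℕ => D.timeAverage (D.multiTime t fhat) n p.1 p.2) atTop
        (𝓝 ((μ[fun x => ∫ ω, D.multiTime t fhat x ω ∂P | D.invariantSigmaAlgebra μ hD]) p.1))) ∧
    (D.IsErgodic μ → ∀ᵐ p ∂(μ.prod P),
      Tendsto (fun n : ℕ => D.timeAverage (D.multiTime t fhat) n p.1 p.2) atTop
        (𝓝 (∫ x, ∫ ω, D.multiTime t fhat x ω ∂P ∂μ))) := by
  choose τ hτ using fun i => h𝕋 (t i) (ht i)
  set F : (ℕ → M) → ℂ := fun y => fhat fun i => y (τ i) with hF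
  have hFm : Measurable F :=
    hfhat.comp (measurable_pi_lambda _ fun i => measurable_pi_apply (τ i))
  have hf : ∀ x ω, D.multiTime t fhat x ω = F (D.trajectory x ω) := fun x ω => by
    simp only [RandomDynamicalSystem.multiTime, hF, RandomDynamicalSystem.trajectory, hτ]
  -- By the cocycle law, restarting at `(x_j, ω_j)` evaluates the original trajectory at times `τ i
  -- + j`, which is the `j`-fold shift.
  have havg : ∀ n x ω, D.timeAverage (D.multiTime t fhat) n x ω
      = birkhoffSum pathShift F n (D.trajectory x ω) / n := fun n x ω => by
    rw [RandomDynamicalSystem.timeAverage, birkhoffSum, one_div, div_eq_inv_mul]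
    congr 1
    refine Finset.sum_congr rfl fun j _ => ?_
    rw [hf, pathShift_iterate]
    simp only [hF, RandomDynamicalSystem.trajectory, Nat.cast_add, D.T_add, Function.comp_apply]
  simp only [hf] at hint
  simp only [havg, hf]
  have hmain := RandomDynamicalSystem.ae_tendsto_birkhoffSum_path h𝕋 hD hFm hint
  rw [D.bind_pathKernel μ] at hmain
  have hmain' := ae_of_ae_map D.measurable_trajectory.aemeasurable hmain
  have h0 : ∀ x ω, D.trajectory x ω 0 = x := fun x ω => by
    simp [RandomDynamicalSystem.trajectory, D.T_zero]
  simp only [h0] at hmain'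
  refine ⟨hmain', fun hE => ?_⟩
  have hc := (Measure.quasiMeasurePreserving_fst (μ := μ) (ν := P)).ae
    (hE.condExp_ae_eq hD hint.integral_prod_left)
  filter_upwards [hmain', hc] with p h1 h2
  rwa [h2] at h1
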